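/- For subsets $X,Y$ of a finite group $G$ let $$\mathrm{pr}(X,Y)=\frac{|\{(x,y)\in X\times Y : xy=yx\}|}{|X|\,|Y|}$$ be the probability that random elements $x\in X$ and $y\in Y$ commute. If a prime $p$ does not divide $|G|$, the trivial subgroup is regarded as the (unique) Sylow $p$-subgroup of $G$. Let $2'$ denote the set of odd primes, and let $\mathrm{pr}^*_G(2',2')$ be the maximum real number $\epsilon$ such that for every pair of distinct odd primes $p,q$ there are a Sylow $p$-subgroup $P$ and a Sylow $q$-subgroup $Q$ of $G$ with $\mathrm{pr}(P,Q)\ge\epsilon$. **Theorem.** Let $G$ be a finite group. If $\mathrm{pr}^*_G(2',2')>7/15$, then $G$ is soluble. The bound $7/15$ is sharp: the alternating group $A_5$ is not soluble and satisfies $\mathrm{pr}^*_{A_5}(2',2')=7/15$. -/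

import Mathlib

/-- `setPr X Y` is the probability that random elements `x ∈ X` and `y ∈ Y` commute, namely
`|{(x, y) ∈ X × Y : x y = y x}| / (|X| |Y|)`, for subsets `X`, `Y` of a finite group. -/
noncomputable def setPr {G : Type*} [Group G] (X Y : Set G) : ℝ :=
  ({z : G × G | z.1 ∈ X ∧ z.2 ∈ Y ∧ z.1 * z.2 = z.2 * z.1}.ncard : ℝ) /
    ((X.ncard : ℝ) * (Y.ncard : ℝ))

/-- The set of real numbers `ε` such that for all distinct primes `p ∈ π₁`, `q ∈ π₂` there are a
Sylow `p`-subgroup `P` and a Sylow `q`-subgroup `Q` of `G` with `pr(P, Q) ≥ ε`.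
(For a prime `p` not dividing `|G|` the only Sylow `p`-subgroup is the trivial one.) -/
def prStarBounds (G : Type*) [Group G] (π₁ π₂ : Set Nat.Primes) : Set ℝ :=
  {ε : ℝ | ∀ p ∈ π₁, ∀ q ∈ π₂, p ≠ q →
    ∃ (P : Sylow (p : ℕ) G) (Q : Sylow (q : ℕ) G), ε ≤ setPr (P : Set G) (Q : Set G)}

/-- `prStar G π₁ π₂` is the maximum of the set `prStarBounds G π₁ π₂`; that the supremum is a
maximum is shown in `isGreatest_prStar`. -/
noncomputable def prStar (G : Type*) [Group G] (π₁ π₂ : Set Nat.Primes) : ℝ :=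
  sSup (prStarBounds G π₁ π₂)

/-- The set `2'` of all odd primes. -/
def oddPrimes : Set Nat.Primes := {⟨2, Nat.prime_two⟩}ᶜ

/-- As soon as there is at least one pair of distinct primes in question, `prStar` is attained. -/
theorem isGreatest_prStar (G : Type*) [Group G] [Finite G] (π₁ π₂ : Set Nat.Primes)
    (h : ∃ p ∈ π₁, ∃ q ∈ π₂, p ≠ q) :
    IsGreatest (prStarBounds G π₁ π₂) (prStar G π₁ π₂) := by
  classical
  let V : Set ℝ := Set.range (fun z : Set G × Set G => setPr z.1 z.2)
  have hV : V.Finite := Set.finite_range _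
  obtain ⟨p₀, hp₀, q₀, hq₀, hpq₀⟩ := h
  have hne : (prStarBounds G π₁ π₂).Nonempty := by
    refine ⟨sInf V, fun p _ q _ _ => ⟨default, default, ?_⟩⟩
    exact csInf_le hV.bddBelow ⟨(_, _), rfl⟩
  have hbdd : BddAbove (prStarBounds G π₁ π₂) := by
    refine ⟨sSup V, fun ε hε => ?_⟩
    obtain ⟨P, Q, hPQ⟩ := hε p₀ hp₀ q₀ hq₀ hpq₀
    exact hPQ.trans (le_csSup hV.bddAbove ⟨(_, _), rfl⟩)
  refine ⟨fun p hp q hq hpq => ?_, fun ε hε => le_csSup hbdd hε⟩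
  obtain ⟨z, hz⟩ := Finite.exists_max
    (fun z : Sylow (p : ℕ) G × Sylow (q : ℕ) G => setPr (z.1 : Set G) (z.2 : Set G))
  refine ⟨z.1, z.2, csSup_le hne fun ε hε => ?_⟩
  obtain ⟨P, Q, hPQ⟩ := hε p hp q hq hpq
  exact hPQ.trans (hz (P, Q))

/-! If `P` and `Q` do not centralize each other, then `C_P(Q)` is proper in `P`, so has index at
least `p`, and any `x` outside it centralizes at most `1/q` of `Q`. Hence `pr(P, Q) ≤ 1/p + (1 -
1/p)/q = (p + q - 1)/(pq)`, at most `7/15` for distinct odd primes (`commute_of_lt_setPr`). A value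
above `7/15` thus makes suitable Sylow subgroups commute elementwise, for every pair of distinct odd
primes.

This property passes to normal subgroups and quotients, so induction reduces solubility to simple
groups. There, if an odd prime `p` divides the order, a nontrivial central element of a Sylow
`p`-subgroup commutes with a Sylow `q`-subgroup for every odd `q`, so its class has 2-power size.
Burnside's theorem (`IsSimpleGroup.mem_center_of_ncard_conjugatesOf`), proved here from the
Wedderburn decomposition of the group algebra, makes it central, so the group is abelian.

For `A₅`, insolubility gives the upper bound; the lower bound counts only commuting pairs with a
trivial entry. -/

/-! ### Means of roots of unity and matrices of finite order -/

/-- An algebraic integer that is the mean of a family of roots of unity is zero or equal to each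
member of the family. -/
theorem eq_zero_or_forall_eq_of_mean_rootsOfUnity {k ι : Type*} [Field k] [CharZero k]
    [Algebra.IsAlgebraic ℚ k] [Fintype ι] {f : ι → k} {m : ℕ} (hm : m ≠ 0) (hf : ∀ i, f i ^ m = 1)
    {a : k} (ha : IsIntegral ℤ a)
    (hmean : (Fintype.card ι : k) * a = ∑ i, f i) :
    a = 0 ∨ ∀ i, f i = a := by
  by_cases ha0 : a = 0
  · exact Or.inl ha0
  right
  rcases isEmpty_or_nonempty ι with hι | hι
  · exact fun i => hι.elim i
  have hcard : (0 : ℝ) < Fintype.card ι := by exact_mod_cast Fintype.card_pos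
  have hnorm : ∀ (Φ : k →+* ℂ) i, ‖Φ (f i)‖ = 1 := fun Φ i =>
    Complex.norm_eq_one_of_pow_eq_one (by rw [← map_pow, hf, map_one]) hm
  have hsum : ∀ Φ : k →+* ℂ,
      (Fintype.card ι : ℂ) * Φ a = ∑ i, Φ (f i) := fun Φ => by
    rw [← map_sum, ← hmean, map_mul, map_natCast]
  have hle : ∀ Φ : k →+* ℂ, ‖Φ a‖ ≤ 1 := fun Φ => by
    have h1 : ‖(Fintype.card ι : ℂ) * Φ a‖ ≤ Fintype.card ι := by
      rw [hsum]
      refine (norm_sum_le _ _).trans ?_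
      simp [hnorm]
    rw [norm_mul, Complex.norm_natCast] at h1
    exact le_of_mul_le_mul_left (by simpa using h1) hcard
  let K : IntermediateField ℚ k := IntermediateField.adjoin ℚ {a}
  have : FiniteDimensional ℚ K :=
    IntermediateField.adjoin.finiteDimensional (Algebra.IsIntegral.isIntegral a)
  have : NumberField K := {}
  have : Algebra.IsAlgebraic K k := Algebra.IsAlgebraic.tower_top (K := ℚ) K
  let x : K := ⟨a, IntermediateField.mem_adjoin_simple_self ℚ a⟩
  have hx : IsIntegral ℤ x :=
    (isIntegral_algHom_iff (K.val.restrictScalars ℤ) K.val.injective).mp ha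
  -- Kronecker's theorem: every conjugate of `a` has absolute value at most 1, so `a` is a root of
  -- unity.
  obtain ⟨n, hn, hpow⟩ := NumberField.Embeddings.pow_eq_one_of_norm_le_one K ℂ (x := x)
    (fun h => ha0 (congrArg Subtype.val h)) hx (fun φ => by
      rw [← NumberField.ComplexEmbedding.lift_algebraMap_apply k φ]
      exact hle _)
  have hpow' : a ^ n = 1 := congrArg Subtype.val hpow
  let Φ : k →+* ℂ := (IsAlgClosed.lift (R := ℚ)).toRingHom
  have hΦa : ‖Φ a‖ = 1 :=
    Complex.norm_eq_one_of_pow_eq_one (by rw [← map_pow, hpow', map_one]) hn.ne'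
  have hinner : ∑ i, inner ℝ (Φ (f i)) (Φ a) = (Fintype.card ι : ℝ) := by
    rw [← sum_inner, ← hsum, ← nsmul_eq_mul, ← Nat.cast_smul_eq_nsmul ℝ, real_inner_smul_left,
      real_inner_self_eq_norm_sq, hΦa]
    simp
  -- Equality case of the triangle inequality: unit vectors whose mean is a unit vector all
  -- coincide.
  have hzero : ∑ i, ‖Φ (f i) - Φ a‖ ^ 2 = 0 := by
    simp_rw [norm_sub_sq_real, hnorm, hΦa]
    rw [Finset.sum_add_distrib, Finset.sum_sub_distrib, ← Finset.mul_sum, hinner]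
    simp
    ring
  intro i
  have := (Finset.sum_eq_zero_iff_of_nonneg (fun i _ => sq_nonneg _)).mp hzero i (Finset.mem_univ i)
  exact Φ.injective (sub_eq_zero.mp (norm_eq_zero.mp (pow_eq_zero_iff two_ne_zero |>.mp this)))

section FiniteOrderMatrix

variable {n : Type*} [Fintype n] [DecidableEq n]

theorem Matrix.pow_eq_one_of_mem_roots_charpoly {k : Type*} [Field k] {A : Matrix n n k} {m : ℕ}
    (hA : A ^ m = 1) {x : k} (hx : x ∈ A.charpoly.roots) : x ^ m = 1 := by
  have h := Polynomial.isRoot_of_mem_roots hx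
  rw [← Matrix.mem_spectrum_iff_isRoot_charpoly] at h
  have h2 := spectrum.subset_polynomial_aeval A (Polynomial.X ^ m) ⟨x, h, rfl⟩
  simp only [map_pow, Polynomial.aeval_X, hA, Polynomial.eval_pow, Polynomial.eval_X] at h2
  rcases isEmpty_or_nonempty n with hn | hn
  · rw [spectrum.of_subsingleton] at h2
    exact h2.elim
  · simpa [spectrum.one_eq] using h2

theorem Matrix.isIntegral_trace_of_pow_eq_one {k : Type*} [Field k] [IsAlgClosed k]
    {A : Matrix n n k} {m : ℕ} (hm : m ≠ 0) (hA : A ^ m = 1) : IsIntegral ℤ A.trace := by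
  rw [Matrix.trace_eq_sum_roots_charpoly]
  refine IsIntegral.multiset_sum fun x hx => ?_
  exact IsIntegral.of_pow (Nat.pos_of_ne_zero hm)
    (by rw [Matrix.pow_eq_one_of_mem_roots_charpoly hA hx]; exact isIntegral_one)

/-- A matrix of finite order all of whose eigenvalues coincide is scalar. -/
theorem Matrix.eq_scalar_of_forall_mem_roots_charpoly {k : Type*} [Field k] [IsAlgClosed k]
    [CharZero k] {A : Matrix n n k} {m : ℕ} (hm : m ≠ 0) (hA : A ^ m = 1) {a : k}
    (ha : ∀ x ∈ A.charpoly.roots, x = a) : A = Matrix.scalar n a := by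
  have h1 : A.charpoly = (Polynomial.X - Polynomial.C a) ^ Fintype.card n := by
    have hs := (IsAlgClosed.splits A.charpoly).eq_prod_roots_of_monic A.charpoly_monic
    rw [Multiset.eq_replicate_of_mem ha, Multiset.map_replicate, Multiset.prod_replicate] at hs
    have hd := congrArg Polynomial.natDegree hs
    rw [Matrix.charpoly_natDegree_eq_dim, Polynomial.natDegree_pow, Polynomial.natDegree_X_sub_C,
      mul_one] at hd
    rw [hs, ← hd]
  have h2 : minpoly k A ∣ (Polynomial.X - Polynomial.C a) ^ Fintype.card n :=
    h1 ▸ Matrix.minpoly_dvd_charpoly A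
  have h3 : minpoly k A ∣ Polynomial.X ^ m - 1 := minpoly.dvd k A (by simp [hA])
  have h4 : Squarefree (minpoly k A) := by
    refine Squarefree.squarefree_of_dvd h3 (Polynomial.Separable.squarefree ?_)
    rw [← Polynomial.C_1]
    exact Polynomial.separable_X_pow_sub_C 1 (Nat.cast_ne_zero.mpr hm) one_ne_zero
  have h5 : minpoly k A ∣ Polynomial.X - Polynomial.C a :=
    h4.isRadical _ _ h2
  have h6 := (minpoly.dvd_iff).mp h5
  rw [map_sub, Polynomial.aeval_X, Polynomial.aeval_C, sub_eq_zero] at h6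
  exact h6

/-- A matrix of finite order whose normalized trace is an algebraic integer has trace zero or is
scalar. -/
theorem Matrix.eq_zero_or_eq_scalar_of_isIntegral {k : Type*} [Field k] [CharZero k] [IsAlgClosed k]
    [Algebra.IsAlgebraic ℚ k] {A : Matrix n n k} {m : ℕ} (hm : m ≠ 0) (hA : A ^ m = 1) {a : k} (ha : IsIntegral ℤ a)
    (htr : (Fintype.card n : k) * a = A.trace) :
    a = 0 ∨ A = Matrix.scalar n a := by
  classical
  have hcard : Fintype.card A.charpoly.roots = Fintype.card n := by
    rw [Multiset.card_coe, ← (IsAlgClosed.splits A.charpoly).natDegree_eq_card_roots,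
      Matrix.charpoly_natDegree_eq_dim]
  refine (eq_zero_or_forall_eq_of_mean_rootsOfUnity (ι := A.charpoly.roots) (f := fun x => x.1)
    hm (fun x => Matrix.pow_eq_one_of_mem_roots_charpoly hA (Multiset.coe_mem (x := x))) ha ?_).imp_right
    fun h => Matrix.eq_scalar_of_forall_mem_roots_charpoly hm hA fun x hx => ?_
  · rw [hcard, htr, Matrix.trace_eq_sum_roots_charpoly, Multiset.sum_eq_sum_coe]
  · exact h ⟨x, ⟨0, Multiset.count_pos.mpr hx⟩⟩

end FiniteOrderMatrix

/-! ### Regular representation and central elements -/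

/-- The trace of left multiplication on a product of matrix algebras. -/
theorem LinearMap.trace_mulLeft_pi_matrix {k ι : Type*} [Field k] [Fintype ι] [DecidableEq ι]
    {d : ι → Type*} [∀ i, Fintype (d i)] [∀ i, DecidableEq (d i)]
    (A : ∀ i, Matrix (d i) (d i) k) :
    LinearMap.trace k _ (LinearMap.mulLeft k A) = ∑ i, (Fintype.card (d i) : k) * (A i).trace := by
  rw [LinearMap.trace_eq_matrix_trace k (Pi.basis fun i => Matrix.stdBasis k (d i) (d i))]
  simp only [Matrix.trace, Matrix.diag, LinearMap.toMatrix_apply, Fintype.sum_sigma,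
    Fintype.sum_prod_type, Pi.basis_repr, Pi.basis_apply, LinearMap.mulLeft_apply]
  refine Finset.sum_congr rfl fun i _ => ?_
  simp [Matrix.stdBasis_eq_single, Finset.mul_sum]
  refine Finset.sum_congr rfl fun a _ => ?_
  have h : ∀ b, (Matrix.stdBasis k (d i) (d i)).repr (A i * Matrix.single a b 1) (a, b) =
      A i a a := fun b => by
    simp [Matrix.stdBasis, Pi.basis_repr]
  simp [h]

section GroupAlgebra

variable {k G : Type*} [Field k] [Group G]

/-- The regular character; compared with the trace on the Wedderburn blocks, it gives the
orthogonality relation used for Burnside's theorem. -/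
theorem MonoidAlgebra.trace_mulLeft [Fintype G] (a : MonoidAlgebra k G) :
    LinearMap.trace k _ (LinearMap.mulLeft k a) = (Fintype.card G : k) * a.coeff 1 := by
  classical
  rw [LinearMap.trace_eq_matrix_trace k (MonoidAlgebra.basis G k)]
  have h : ∀ x : G, ((MonoidAlgebra.basis G k).repr (a * MonoidAlgebra.single x 1)) x =
      a.coeff 1 := fun x => by
    change (a * MonoidAlgebra.single x 1).coeff x = _
    simp [MonoidAlgebra.coeff_mul_single_apply]
  simp only [Matrix.trace, Matrix.diag, LinearMap.toMatrix_apply, LinearMap.mulLeft_apply,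
    MonoidAlgebra.basis_apply, h, Finset.sum_const, Finset.card_univ, nsmul_eq_mul]

variable {n : Type*} [Fintype n] [DecidableEq n]

/-- Schur's lemma: by surjectivity the image commutes with all matrix units. -/
theorem MonoidAlgebra.exists_eq_scalar_of_commute {φ : MonoidAlgebra k G →ₐ[k] Matrix n n k}
    (hφ : Function.Surjective φ) {a : MonoidAlgebra k G}
    (ha : ∀ x, Commute (MonoidAlgebra.of k G x) a) : ∃ c, φ a = Matrix.scalar n c := by
  have h : ∀ b, Commute b a := fun b => by
    induction b using MonoidAlgebra.induction_on with
    | of m => exact ha m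
    | add x y hx hy => exact hx.add_left hy
    | smul r x hx => exact hx.smul_left r
  obtain ⟨c, hc⟩ := Matrix.mem_range_scalar_iff_commute_single'.mpr fun i j => by
    obtain ⟨b, hb⟩ := hφ (Matrix.single i j 1)
    rw [← hb]
    exact (h b).map φ
  exact ⟨c, hc.symm⟩

/-- An irreducible representation of a finite group sends the sum of all elements either to zero,
or else it is trivial. -/
theorem MonoidAlgebra.map_sum_of_eq_zero_or_forall_map_of_eq_one [Fintype G]
    {φ : MonoidAlgebra k G →ₐ[k] Matrix n n k} (hφ : Function.Surjective φ) :
    φ (∑ x, MonoidAlgebra.of k G x) = 0 ∨ ∀ x, φ (MonoidAlgebra.of k G x) = 1 := by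
  have hl : ∀ x, MonoidAlgebra.of k G x * ∑ y, MonoidAlgebra.of k G y =
      ∑ y, MonoidAlgebra.of k G y := fun x => by
    simp_rw [Finset.mul_sum, ← map_mul]
    exact Fintype.sum_equiv (Equiv.mulLeft x) _ _ fun _ => rfl
  have hr : ∀ x, (∑ y, MonoidAlgebra.of k G y) * MonoidAlgebra.of k G x =
      ∑ y, MonoidAlgebra.of k G y := fun x => by
    simp_rw [Finset.sum_mul, ← map_mul]
    exact Fintype.sum_equiv (Equiv.mulRight x) _ _ fun _ => rfl
  obtain ⟨c, hc⟩ := MonoidAlgebra.exists_eq_scalar_of_commute hφ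
    fun x => (hl x).trans (hr x).symm
  by_cases h0 : c = 0
  · exact Or.inl (by rw [hc, h0, map_zero])
  · refine Or.inr fun x => ?_
    have h := congrArg φ (hl x)
    rw [map_mul, hc] at h
    have hu : IsUnit (Matrix.scalar n c) := (isUnit_iff_ne_zero.mpr h0).map (Matrix.scalar n)
    exact hu.mul_left_injective (h.trans (one_mul _).symm)

/-- If the conjugacy class of `g` has prime power size, then in each irreducible representation of
dimension prime to `p` either the character vanishes at `g` or `g` acts by a scalar. -/
theorem MonoidAlgebra.trace_eq_zero_or_eq_scalar_of_coprime [Finite G] [CharZero k] [IsAlgClosed k]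
    [Algebra.IsAlgebraic ℚ k] [Nonempty n] {φ : MonoidAlgebra k G →ₐ[k] Matrix n n k}
    (hφ : Function.Surjective φ) {g : G}
    (h : (Fintype.card n).Coprime (conjugatesOf g).ncard) :
    (φ (MonoidAlgebra.of k G g)).trace = 0 ∨ ∃ c, φ (MonoidAlgebra.of k G g) = Matrix.scalar n c := by
  classical
  have hm : Nat.card G ≠ 0 := Nat.card_pos.ne'
  have hpow : φ (MonoidAlgebra.of k G g) ^ Nat.card G = 1 := by
    rw [← map_pow, ← map_pow, pow_card_eq_one', map_one, map_one]
  let s : Finset G := (Set.toFinite (conjugatesOf g)).toFinset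
  have hs : ∀ x, x ∈ s ↔ IsConj g x := fun x => Set.Finite.mem_toFinset _
  have hcard : s.card = (conjugatesOf g).ncard := (Set.ncard_eq_toFinset_card _ _).symm
  -- The class sum is central, so it acts by a scalar `w`; `w` is an algebraic integer because `a`
  -- comes from the integral group ring.
  let a : MonoidAlgebra k G := ∑ x ∈ s, MonoidAlgebra.of k G x
  obtain ⟨w, hw⟩ := MonoidAlgebra.exists_eq_scalar_of_commute hφ (a := a) fun x => by
    change _ * _ = _ * _
    simp_rw [a, Finset.mul_sum, Finset.sum_mul, ← map_mul]
    refine Finset.sum_equiv (MulAut.conj x).toEquiv (fun y => ?_) fun y _ => ?_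
    · rw [hs, hs]
      exact ⟨fun hy => hy.trans (isConj_iff.mpr ⟨x, rfl⟩),
        fun hy => hy.trans (isConj_iff.mpr ⟨x, rfl⟩ : IsConj y _).symm⟩
    · simp
  have hw_int : IsIntegral ℤ w := by
    have h1 : IsIntegral ℤ (φ a) := by
      have h2 := (IsIntegral.of_finite ℤ (∑ x ∈ s, MonoidAlgebra.of ℤ G x)).map
        (MonoidAlgebra.lift ℤ (Matrix n n k) G
          ((φ : MonoidAlgebra k G →* Matrix n n k).comp (MonoidAlgebra.of k G)))
      simpa [a] using h2
    rw [hw] at h1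
    exact (isIntegral_algebraMap_iff (R := ℤ) (A := k) (B := Matrix n n k)
      (algebraMap k (Matrix n n k)).injective).mp h1
  have htr : (Fintype.card n : k) * w = (conjugatesOf g).ncard *
      (φ (MonoidAlgebra.of k G g)).trace := by
    have h1 : (φ a).trace = (Fintype.card n : k) * w := by
      rw [hw]
      simp [Matrix.trace]
    rw [← h1, ← hcard]
    simp only [a, map_sum, Matrix.trace_sum]
    rw [← nsmul_eq_mul, ← Finset.sum_const]
    refine Finset.sum_congr rfl fun x hx => ?_
    obtain ⟨y, rfl⟩ := isConj_iff.mp ((hs x).mp hx)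
    rw [map_mul, map_mul, Matrix.trace_mul_comm, ← map_mul, ← map_mul]
    simp
  set t := (φ (MonoidAlgebra.of k G g)).trace
  have ht_int : IsIntegral ℤ t := Matrix.isIntegral_trace_of_pow_eq_one hm hpow
  obtain ⟨u, v, huv⟩ := Int.isCoprime_iff_gcd_eq_one.mpr
    (show Int.gcd (Fintype.card n) (conjugatesOf g).ncard = 1 from h)
  have huv' : (u : k) * Fintype.card n + v * (conjugatesOf g).ncard = 1 := by exact_mod_cast huv
  -- By Bézout, the normalized character value `t / dim` is the algebraic integer `u * t + v * w`.
  have hmean : (Fintype.card n : k) * (u * t + v * w) = t := by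
    linear_combination (t : k) * huv' + v * htr
  have hint : ∀ z : ℤ, IsIntegral ℤ (z : k) := fun z => isIntegral_algebraMap (x := z)
  rcases Matrix.eq_zero_or_eq_scalar_of_isIntegral hm hpow
    (((hint u).mul ht_int).add ((hint v).mul hw_int)) hmean with h0 | h0
  · left
    rw [← hmean, h0, mul_zero]
  · exact Or.inr ⟨_, h0⟩

end GroupAlgebra

/-! ### Burnside's theorem -/

/-- **Burnside's theorem on conjugacy classes of prime power size**: in a finite simple group, an
element whose conjugacy class has prime power size is central. -/
theorem IsSimpleGroup.mem_center_of_ncard_conjugatesOf {G : Type*} [Group G] [Finite G]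
    [IsSimpleGroup G] {p j : ℕ} (hp : p.Prime) {g : G} (h : (conjugatesOf g).ncard = p ^ j) :
    g ∈ Subgroup.center G := by
  classical
  by_contra hg
  have hg1 : g ≠ 1 := fun h => hg (h ▸ one_mem _)
  have := Fintype.ofFinite G
  let k := AlgebraicClosure ℚ
  have : Algebra.IsAlgebraic ℚ k := by
    have h : (AlgebraicClosure.instAlgebra ℚ : Algebra ℚ k) = DivisionRing.toRatAlgebra :=
      Subsingleton.elim _ _
    exact h ▸ AlgebraicClosure.isAlgebraic ℚ
  obtain ⟨N, d, hd, ⟨e⟩⟩ :=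
    IsSemisimpleRing.exists_algEquiv_pi_matrix_of_isAlgClosed k (MonoidAlgebra k G)
  let φ : ∀ i, MonoidAlgebra k G →ₐ[k] Matrix (Fin (d i)) (Fin (d i)) k := fun i =>
    (Pi.evalAlgHom k _ i).comp e.toAlgHom
  have hφ : ∀ i, Function.Surjective (φ i) := fun i =>
    (Function.surjective_eval i).comp e.surjective
  have htrace : ∀ a, ∑ i, (d i : k) * (φ i a).trace = (Fintype.card G : k) * a.coeff 1 :=
    fun a => by
      rw [← MonoidAlgebra.trace_mulLeft, ← LinearMap.trace_conj' _ e.toLinearEquiv]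
      have : e.toLinearEquiv.conj (LinearMap.mulLeft k a) = LinearMap.mulLeft k (e a) := by
        refine LinearMap.ext fun x => ?_
        simp [LinearEquiv.conj_apply]
      rw [this, LinearMap.trace_mulLeft_pi_matrix]
      simp [φ]
  let T : Finset (Fin N) := Finset.univ.filter fun i => ∀ x, φ i (MonoidAlgebra.of k G x) = 1
  -- Evaluating the regular character on the sum of all group elements isolates the trivial blocks.
  have htriv : ∑ i ∈ T, (d i : k) * d i = 1 := by
    have h1 := htrace (∑ x, MonoidAlgebra.of k G x)
    have h2 : (∑ x, MonoidAlgebra.of k G x).coeff 1 = 1 := by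
      simp [MonoidAlgebra.coeff_sum, Finsupp.single_apply]
    have h3 : ∀ i, (d i : k) * (φ i (∑ x, MonoidAlgebra.of k G x)).trace =
        if i ∈ T then (Fintype.card G : k) * (d i * d i) else 0 := fun i => by
      split_ifs with hi
      · simp only [T, Finset.mem_filter, Finset.mem_univ, true_and] at hi
        simp only [map_sum, hi, Finset.sum_const, Matrix.trace_smul, Matrix.trace_one]
        simp
        ring
      · rw [(MonoidAlgebra.map_sum_of_eq_zero_or_forall_map_of_eq_one (hφ i)).resolve_right
          (by simpa [T] using hi)]
        simp
    simp_rw [h3, h2] at h1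
    rw [← Finset.sum_filter, Finset.filter_mem_eq_inter, Finset.univ_inter, ← Finset.mul_sum] at h1
    exact mul_left_cancel₀ (Nat.cast_ne_zero.mpr Fintype.card_ne_zero) h1
  have hnontriv : ∀ i ∉ T, ∃ b : k, IsIntegral ℤ b ∧
      (d i : k) * (φ i (MonoidAlgebra.of k G g)).trace = p * b := fun i hi => by
    have hne : Nonempty (Fin (d i)) := ⟨0⟩
    by_cases hdvd : p ∣ d i
    · obtain ⟨q, hq⟩ := hdvd
      refine ⟨q * (φ i (MonoidAlgebra.of k G g)).trace,
        (isIntegral_algebraMap (R := ℤ) (x := (q : ℤ))).mul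
          (Matrix.isIntegral_trace_of_pow_eq_one (m := Nat.card G) Nat.card_pos.ne' ?_), ?_⟩
      · rw [← map_pow, ← map_pow, pow_card_eq_one', map_one, map_one]
      · have hq' : (d i : k) = p * q := by rw [hq, Nat.cast_mul]
        linear_combination (φ i (MonoidAlgebra.of k G g)).trace * hq'
    · refine ⟨0, isIntegral_zero, ?_⟩
      have hcop : (Fintype.card (Fin (d i))).Coprime (conjugatesOf g).ncard := by
        rw [h, Fintype.card_fin]
        exact ((hp.coprime_iff_not_dvd.mpr hdvd).pow_left j).symm
      rcases MonoidAlgebra.trace_eq_zero_or_eq_scalar_of_coprime (hφ i) hcop with h0 | ⟨c, hc⟩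
      · rw [h0, mul_zero, mul_zero]
      · exfalso
        let ρ : G →* Matrix (Fin (d i)) (Fin (d i)) k :=
          (φ i : MonoidAlgebra k G →* _).comp (MonoidAlgebra.of k G)
        have hker : ρ.ker = ⊥ := (MonoidHom.normal_ker ρ).eq_bot_or_eq_top.resolve_right
          fun htop => hi (by
            simp only [T, Finset.mem_filter, Finset.mem_univ, true_and]
            exact fun x => MonoidHom.mem_ker.mp (htop ▸ Subgroup.mem_top x : x ∈ ρ.ker))
        -- A nontrivial representation of a simple group is faithful, so `g` acting by a scalar
        -- would be central.
        have hinj : Function.Injective ρ := (MonoidHom.ker_eq_bot_iff ρ).mp hker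
        refine hg (Subgroup.mem_center_iff.mpr fun x => hinj ?_)
        rw [map_mul, map_mul]
        have : ρ g = Matrix.scalar _ c := hc
        rw [this]
        exact (Matrix.scalar_commute c (Commute.all c) _).symm
  choose! b hb hb' using hnontriv
  have hsum := htrace (MonoidAlgebra.of k G g)
  have hg0 : (MonoidAlgebra.of k G g).coeff 1 = 0 := by
    simp [hg1]
  rw [hg0, mul_zero, ← Finset.sum_add_sum_compl T] at hsum
  have hT : ∑ i ∈ T, (d i : k) * (φ i (MonoidAlgebra.of k G g)).trace = 1 := by
    rw [← htriv]
    refine Finset.sum_congr rfl fun i hi => ?_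
    simp only [T, Finset.mem_filter, Finset.mem_univ, true_and] at hi
    rw [hi g, Matrix.trace_one, Fintype.card_fin]
  rw [hT, Finset.sum_congr rfl fun i hi => hb' i (Finset.mem_compl.mp hi), ← Finset.mul_sum] at hsum
  have hB : IsIntegral ℤ (∑ i ∈ Tᶜ, b i) :=
    IsIntegral.sum _ fun i hi => hb i (Finset.mem_compl.mp hi)
  have hp0 : (p : k) ≠ 0 := Nat.cast_ne_zero.mpr hp.ne_zero
  -- The regular character at `g ≠ 1` reads `0 = 1 + p * ∑ b i`, so `-1/p` would be an algebraic
  -- integer.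
  have hq : IsIntegral ℤ (-(p : ℚ)⁻¹) := by
    refine (isIntegral_algebraMap_iff (R := ℤ) (A := ℚ) (B := k) (algebraMap ℚ k).injective).mp ?_
    convert hB
    rw [map_neg, map_inv₀, map_natCast]
    refine mul_left_cancel₀ hp0 ?_
    rw [mul_neg, mul_inv_cancel₀ hp0]
    linear_combination -hsum
  obtain ⟨z, hz⟩ := IsIntegrallyClosed.isIntegral_iff.mp hq
  have hz' : (p : ℤ) * -z = 1 := by
    have hp0' : (p : ℚ) ≠ 0 := Nat.cast_ne_zero.mpr hp.ne_zero
    have : (p : ℚ) * -(z : ℚ) = 1 := by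
      rw [show (z : ℚ) = -(p : ℚ)⁻¹ from hz]
      field_simp
    exact_mod_cast this
  exact hp.one_lt.ne' (Int.natCast_dvd_natCast.mp ⟨-z, by simpa using hz'.symm⟩ |> Nat.dvd_one.mp)

/-! ### Solubility from commuting Sylow subgroups -/

section CommutingSylows

/-- For any two distinct odd primes there are Sylow subgroups that centralize each other. -/
def HasCommutingOddSylows (G : Type*) [Group G] : Prop :=
  ∀ p q : ℕ, p.Prime → q.Prime → p ≠ 2 → q ≠ 2 → p ≠ q →
    ∃ (P : Sylow p G) (Q : Sylow q G), ∀ x ∈ P, ∀ y ∈ Q, Commute x y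

variable {G : Type*} [Group G]

/-- `|N : H ∩ N| = |HN : H|` when `N` is normal, and this divides `|G : H|`. -/
theorem Subgroup.relIndex_dvd_index_of_normal_right [Finite G] (H N : Subgroup G) [N.Normal] :
    H.relIndex N ∣ H.index := by
  have h1 : (H ⊓ N).relIndex H * H.relIndex (H ⊔ N) = (H ⊓ N).relIndex N * N.relIndex (H ⊔ N) := by
    rw [relIndex_mul_relIndex _ _ _ inf_le_left le_sup_left,
      relIndex_mul_relIndex _ _ _ inf_le_right le_sup_right]
  rw [inf_relIndex_left, inf_relIndex_right, relIndex_sup_right, mul_comm] at h1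
  have h2 := Nat.eq_of_mul_eq_mul_right
    (Nat.pos_of_ne_zero ((index_ne_zero_of_finite : (N.subgroupOf H).index ≠ 0))) h1
  rw [← h2]
  exact relIndex_dvd_index_of_le le_sup_left

theorem Sylow.exists_coe_eq_subgroupOf_of_normal [Finite G] {p : ℕ} [Fact p.Prime] (P : Sylow p G)
    (N : Subgroup G) [N.Normal] : ∃ S : Sylow p N, (S : Subgroup N) = (P : Subgroup G).subgroupOf N :=
  ⟨IsPGroup.toSylow (P := (P : Subgroup G).subgroupOf N) P.isPGroup'.comap_subtype fun h =>
      P.not_dvd_index (h.trans (Subgroup.relIndex_dvd_index_of_normal_right (P : Subgroup G) N)),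
    IsPGroup.toSylow_coe _ _⟩

theorem HasCommutingOddSylows.subgroup [Finite G] (h : HasCommutingOddSylows G) (N : Subgroup G)
    [N.Normal] : HasCommutingOddSylows N := by
  intro p q hp hq hp2 hq2 hpq
  have := Fact.mk hp
  have := Fact.mk hq
  obtain ⟨P, Q, hPQ⟩ := h p q hp hq hp2 hq2 hpq
  obtain ⟨P', hP'⟩ := P.exists_coe_eq_subgroupOf_of_normal N
  obtain ⟨Q', hQ'⟩ := Q.exists_coe_eq_subgroupOf_of_normal N
  refine ⟨P', Q', fun x hx y hy => Subtype.ext (hPQ x ?_ y ?_)⟩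
  · have : x ∈ (P' : Subgroup N) := hx
    rwa [hP'] at this
  · have : y ∈ (Q' : Subgroup N) := hy
    rwa [hQ'] at this

theorem HasCommutingOddSylows.of_surjective [Finite G] {H : Type*} [Group H]
    (h : HasCommutingOddSylows G) {f : G →* H} (hf : Function.Surjective f) :
    HasCommutingOddSylows H := by
  intro p q hp hq hp2 hq2 hpq
  have := Fact.mk hp
  have := Fact.mk hq
  obtain ⟨P, Q, hPQ⟩ := h p q hp hq hp2 hq2 hpq
  refine ⟨P.mapSurjective hf, Q.mapSurjective hf, ?_⟩
  rintro _ ⟨x, hx, rfl⟩ _ ⟨y, hy, rfl⟩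
  exact (hPQ x hx y hy).map f

theorem ncard_conjugatesOf_eq_index_centralizer (g : G) :
    (conjugatesOf g).ncard = (Subgroup.centralizer {g}).index := by
  rw [show (Subgroup.centralizer {g}).index = (MulAction.stabilizer (ConjAct G) g).index from
    congrArg Subgroup.index (ConjAct.stabilizer_eq_centralizer g).symm, MulAction.index_stabilizer,
    ConjAct.orbit_eq_carrier_conjClasses]
  rfl

theorem HasCommutingOddSylows.exists_ncard_conjugatesOf_eq_two_pow [Finite G]
    (h : HasCommutingOddSylows G) {p : ℕ} (hp : p.Prime) (hp2 : p ≠ 2) (hdvd : p ∣ Nat.card G) :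
    ∃ z : G, z ≠ 1 ∧ ∃ j, (conjugatesOf z).ncard = 2 ^ j := by
  have := Fact.mk hp
  let P : Sylow p G := default
  have hP : Nontrivial P := (Subgroup.nontrivial_iff_ne_bot _).mpr (P.ne_bot_of_dvd_card hdvd)
  have hZ := P.isPGroup'.center_nontrivial
  obtain ⟨⟨z, hz⟩, hz1⟩ := exists_ne (1 : Subgroup.center P)
  refine ⟨z, fun h1 => hz1 (Subtype.ext (Subtype.ext h1)), ?_⟩
  refine (Nat.eq_two_pow_or_exists_odd_prime_and_dvd _).resolve_right ?_
  rintro ⟨q, hq, hqdvd, hq2⟩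
  have := Fact.mk hq
  have key : ∀ (w : G) (Q : Sylow q G), IsConj w z → (∀ y ∈ Q, Commute w y) → False := by
    intro w Q hwz hw
    rw [← hwz.conjugatesOf_eq, ncard_conjugatesOf_eq_index_centralizer] at hqdvd
    refine Q.not_dvd_index (hqdvd.trans (Subgroup.index_dvd_of_le fun y hy => ?_))
    exact Subgroup.mem_centralizer_singleton_iff.mpr (hw y hy).symm
  by_cases hpq : q = p
  · subst hpq
    refine key z P (IsConj.refl _) fun y hy => ?_
    exact (congrArg Subtype.val (Subgroup.mem_center_iff.mp hz ⟨y, hy⟩)).symm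
  · obtain ⟨P', Q, hPQ⟩ := h p q hp hq hp2 (fun h => absurd (h ▸ hq2) (by decide)) (Ne.symm hpq)
    -- The `P'` paired with `Q` depends on `q`; conjugating it to `P` carries some `w ∈ P'` to `z`,
    -- and class size is unaffected.
    obtain ⟨g, hg⟩ := MulAction.exists_smul_eq G P' P
    have hzP : (z : G) ∈ ((g • P' : Sylow p G) : Subgroup G) := by
      rw [hg]
      exact z.2
    rw [Sylow.coe_subgroup_smul] at hzP
    obtain ⟨w, hw, hwz⟩ := hzP
    exact key w Q (isConj_iff.mpr ⟨g, hwz⟩) (hPQ w hw)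

/-- Finite groups in which Sylow subgroups for distinct odd primes can be chosen to centralize each
other are soluble. -/
theorem HasCommutingOddSylows.isSolvable {G : Type*} [Group G] [Finite G]
    (h : HasCommutingOddSylows G) : Group.IsSolvable G := by
  induction hn : Nat.card G using Nat.strong_induction_on generalizing G with
  | _ n ih =>
  subst hn
  rcases subsingleton_or_nontrivial G with _ | _
  · infer_instance
  by_cases hN : ∃ N : Subgroup G, N.Normal ∧ N ≠ ⊥ ∧ N ≠ ⊤
  · obtain ⟨N, _, hbot, htop⟩ := hN
    have hcard := N.card_eq_card_quotient_mul_card_subgroup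
    have h1 : 1 < Nat.card N := N.one_lt_card_iff_ne_bot.mpr hbot
    have h2 : 1 < N.index := Subgroup.one_lt_index_of_ne_top htop
    rw [Subgroup.index] at h2
    refine (Group.isSolvable_iff_subgroup_quotient N).mpr ⟨ih _ ?_ (h.subgroup N) rfl,
      ih _ ?_ (h.of_surjective (QuotientGroup.mk'_surjective N)) rfl⟩ <;> nlinarith
  · have : IsSimpleGroup G := ⟨fun N hNn => by
      by_contra! hne
      exact hN ⟨N, hNn, hne⟩⟩
    rcases Nat.eq_two_pow_or_exists_odd_prime_and_dvd (Nat.card G) with ⟨j, hj⟩ | ⟨p, hp, hdvd, hp2⟩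
    · have := Fact.mk Nat.prime_two
      have := (IsPGroup.of_card hj).isNilpotent
      infer_instance
    · obtain ⟨z, hz1, j, hj⟩ :=
        h.exists_ncard_conjugatesOf_eq_two_pow hp (fun h => absurd (h ▸ hp2) (by decide)) hdvd
      have hz := IsSimpleGroup.mem_center_of_ncard_conjugatesOf Nat.prime_two hj
      have hZ : Subgroup.center G = ⊤ :=
        (inferInstance : (Subgroup.center G).Normal).eq_bot_or_eq_top.resolve_left fun hbot =>
          hz1 (Subgroup.mem_bot.mp (hbot ▸ hz))
      exact Group.isSolvable_of_comm fun a b =>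
        Subgroup.mem_center_iff.mp (hZ ▸ Subgroup.mem_top b) a

end CommutingSylows

/-! ### Counting commuting pairs -/

section CommutingProbability

variable {G : Type*} [Group G]

theorem IsPGroup.card_mul_le_of_lt [Finite G] {p : ℕ} [hp : Fact p.Prime] {H K : Subgroup G}
    (hK : IsPGroup p K) (h : H < K) : Nat.card H * p ≤ Nat.card K := by
  obtain ⟨m, hm⟩ := IsPGroup.iff_card.mp (hK.to_le h.le)
  obtain ⟨n, hn⟩ := IsPGroup.iff_card.mp hK
  have hlt : Nat.card H < Nat.card K := Set.ncard_lt_ncard h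
  rw [hm, hn] at hlt ⊢
  rw [← pow_succ]
  exact Nat.pow_le_pow_right hp.out.pos ((Nat.pow_lt_pow_iff_right hp.out.one_lt).mp hlt)

/-- The number of commuting pairs, counted by first coordinates. -/
theorem ncard_commuting_pairs [Fintype G] [DecidableEq G] (P Q : Subgroup G)
    [DecidablePred (· ∈ P)] :
    {z : G × G | z.1 ∈ P ∧ z.2 ∈ Q ∧ z.1 * z.2 = z.2 * z.1}.ncard =
      ∑ x with x ∈ P, Nat.card (Q ⊓ Subgroup.centralizer {x} : Subgroup G) := by
  classical
  rw [Set.ncard_eq_toFinset_card', Finset.card_eq_sum_card_fiberwise (f := Prod.fst)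
    (t := Finset.univ.filter (· ∈ P)) (fun z hz => by simp at hz; simp [hz.1])]
  refine Finset.sum_congr rfl fun x hx => ?_
  change _ = Set.ncard ((Q ⊓ Subgroup.centralizer {x} : Subgroup G) : Set G)
  rw [Set.ncard_eq_toFinset_card']
  refine Finset.card_nbij' Prod.snd (fun y => (x, y)) ?_ ?_ ?_ ?_
  · rintro ⟨a, b⟩ h
    simp only [Finset.coe_filter, Set.mem_toFinset, Set.mem_ofPred_eq] at h
    obtain ⟨⟨-, hb, hab⟩, rfl⟩ := h
    simpa using ⟨hb, Subgroup.mem_centralizer_singleton_iff.mpr hab.symm⟩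
  · intro y hy
    simp only [Set.coe_toFinset, SetLike.mem_coe, Subgroup.mem_inf] at hy
    simpa using ⟨by simpa using hx, hy.1, (Subgroup.mem_centralizer_singleton_iff.mp hy.2).symm⟩
  · rintro ⟨a, b⟩ h
    simp only [Finset.coe_filter, Set.mem_ofPred_eq] at h
    rw [← h.2]
  · exact fun _ _ => rfl

theorem ncard_commuting_pairs_le [Finite G] {p q : ℕ} [hp : Fact p.Prime] [hq : Fact q.Prime]
    {P Q : Subgroup G} (hP : IsPGroup p P) (hQ : IsPGroup q Q)
    (hPQ : ¬ ∀ x ∈ P, ∀ y ∈ Q, Commute x y) :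
    p * q * {z : G × G | z.1 ∈ P ∧ z.2 ∈ Q ∧ z.1 * z.2 = z.2 * z.1}.ncard ≤
      (p + q - 1) * (Nat.card P * Nat.card Q) := by
  classical
  have := Fintype.ofFinite G
  rw [ncard_commuting_pairs]
  let P₀ := P ⊓ Subgroup.centralizer (Q : Set G)
  have hP₀ : Nat.card P₀ * p ≤ Nat.card P := hP.card_mul_le_of_lt <| inf_le_left.lt_of_ne fun h =>
    hPQ fun x hx y hy => ((inf_eq_left.mp h hx) y hy).symm
  have hterm : ∀ x ∈ P, q * Nat.card (Q ⊓ Subgroup.centralizer {x} : Subgroup G) ≤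
      Nat.card Q + if x ∈ P₀ then (q - 1) * Nat.card Q else 0 := fun x hx => by
    obtain ⟨q', rfl⟩ := Nat.exists_eq_add_of_le' hq.out.one_le
    split_ifs with hx0
    · have : Nat.card (Q ⊓ Subgroup.centralizer {x} : Subgroup G) ≤ Nat.card Q :=
        Subgroup.card_le_of_le inf_le_left
      rw [Nat.add_sub_cancel]
      nlinarith
    · rw [add_zero, mul_comm]
      refine hQ.card_mul_le_of_lt (inf_le_left.lt_of_ne fun h => hx0 ⟨hx, fun y hy => ?_⟩)
      exact Subgroup.mem_centralizer_singleton_iff.mp (inf_eq_left.mp h hy)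
  have hPcard : (Finset.univ.filter (· ∈ P)).card = Nat.card P := by
    rw [Nat.card_eq_fintype_card, Fintype.card_subtype]
  have hP₀card : ((Finset.univ.filter (· ∈ P)).filter (· ∈ P₀)).card = Nat.card P₀ := by
    rw [Nat.card_eq_fintype_card, Fintype.card_subtype, Finset.filter_filter]
    congr 1
    ext x
    simp only [Finset.mem_filter, Finset.mem_univ, true_and, and_iff_right_iff_imp]
    exact fun hx => hx.1
  have hsum := Finset.sum_le_sum fun x (hx : x ∈ Finset.univ.filter (· ∈ P)) =>
    hterm x (Finset.mem_filter.mp hx).2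
  rw [← Finset.mul_sum, Finset.sum_add_distrib, Finset.sum_const, ← Finset.sum_filter,
    Finset.sum_const, hPcard, hP₀card, smul_eq_mul, smul_eq_mul] at hsum
  obtain ⟨q', rfl⟩ := Nat.exists_eq_add_of_le' hq.out.one_le
  rw [Nat.add_sub_cancel] at hsum
  rw [← add_assoc, Nat.add_sub_cancel]
  calc _ = p * ((q' + 1) * _) := by ring
    _ ≤ p * _ := Nat.mul_le_mul_left _ hsum
    _ = p * (Nat.card P * Nat.card Q) + (Nat.card P₀ * p) * (q' * Nat.card Q) := by ring
    _ ≤ p * (Nat.card P * Nat.card Q) + Nat.card P * (q' * Nat.card Q) := by gcongr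
    _ = _ := by ring

/-- Pairs with a trivial coordinate commute; only `(1, 1)` is counted twice. -/
theorem le_ncard_commuting_pairs [Finite G] (P Q : Subgroup G) :
    Nat.card P + Nat.card Q ≤
      {z : G × G | z.1 ∈ P ∧ z.2 ∈ Q ∧ z.1 * z.2 = z.2 * z.1}.ncard + 1 := by
  have hunion := Set.ncard_union_add_ncard_inter ((P : Set G) ×ˢ ({1} : Set G))
    (({1} : Set G) ×ˢ (Q : Set G))
  rw [Set.ncard_prod, Set.ncard_prod, Set.ncard_singleton, mul_one, one_mul] at hunion
  change Set.ncard (P : Set G) + Set.ncard (Q : Set G) ≤ _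
  rw [← hunion]
  refine Nat.add_le_add (Set.ncard_le_ncard ?_) ((Set.ncard_le_one (Set.toFinite _)).mpr ?_)
  · rintro ⟨x, y⟩ (⟨hx, hy⟩ | ⟨hx, hy⟩)
    · obtain rfl : y = 1 := hy
      exact ⟨hx, one_mem _, by simp⟩
    · obtain rfl : x = 1 := hx
      exact ⟨one_mem _, hy, by simp⟩
  · rintro ⟨x, y⟩ ⟨⟨_, hy⟩, ⟨hx, _⟩⟩ ⟨x', y'⟩ ⟨⟨_, hy'⟩, ⟨hx', _⟩⟩
    simp only [Set.mem_singleton_iff] at hy hx hx' hy'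
    rw [hx, hy, hx', hy']

theorem setPr_coe (P Q : Subgroup G) : setPr (P : Set G) (Q : Set G) =
    ({z : G × G | z.1 ∈ P ∧ z.2 ∈ Q ∧ z.1 * z.2 = z.2 * z.1}.ncard : ℝ) /
      (Nat.card P * Nat.card Q) := rfl

theorem commute_of_lt_setPr [Finite G] {p q : ℕ} (hp : p.Prime) (hq : q.Prime) (hp2 : p ≠ 2)
    (hq2 : q ≠ 2) (hpq : p ≠ q) {P Q : Subgroup G} (hP : IsPGroup p P) (hQ : IsPGroup q Q)
    (h : 7 / 15 < setPr (P : Set G) (Q : Set G)) : ∀ x ∈ P, ∀ y ∈ Q, Commute x y := by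
  have := Fact.mk hp
  have := Fact.mk hq
  by_contra hPQ
  have hle := ncard_commuting_pairs_le hP hQ hPQ
  have hpos : 0 < Nat.card P * Nat.card Q := Nat.mul_pos Nat.card_pos Nat.card_pos
  rw [setPr_coe, lt_div_iff₀ (by exact_mod_cast hpos)] at h
  set N := {z : G × G | z.1 ∈ P ∧ z.2 ∈ Q ∧ z.1 * z.2 = z.2 * z.1}.ncard
  have h' : 7 * (Nat.card P * Nat.card Q) < 15 * N := by
    have : (7 : ℝ) * (Nat.card P * Nat.card Q) < 15 * N := by linarith
    exact_mod_cast this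
  -- Equality occurs at `{3, 5}`. Distinctness and `p, q ≠ 4` force one of the primes to be at least
  -- 5.
  have hodd : 15 * (p + q - 1) ≤ 7 * (p * q) := by
    have hp3 : 3 ≤ p := by have := hp.two_le; lia
    have hq3 : 3 ≤ q := by have := hq.two_le; lia
    have hp4 : p ≠ 4 := fun h => by rw [h] at hp; exact absurd hp (by norm_num)
    have hq4 : q ≠ 4 := fun h => by rw [h] at hq; exact absurd hq (by norm_num)
    obtain ⟨a, rfl⟩ := Nat.exists_eq_add_of_le' hp3
    obtain ⟨b, rfl⟩ := Nat.exists_eq_add_of_le' hq3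
    have : 2 ≤ a ∨ 2 ≤ b := by lia
    have h1 : a + 3 + (b + 3) - 1 = a + b + 5 := by lia
    rw [h1]
    rcases this with h | h <;> nlinarith [Nat.zero_le (a * b)]
  have hpq0 : 0 < p * q := Nat.mul_pos hp.pos hq.pos
  have : 15 * (p * q * N) ≤ 7 * (p * q) * (Nat.card P * Nat.card Q) :=
    calc _ ≤ 15 * ((p + q - 1) * (Nat.card P * Nat.card Q)) := Nat.mul_le_mul_left _ hle
      _ = 15 * (p + q - 1) * (Nat.card P * Nat.card Q) := by ring
      _ ≤ _ := Nat.mul_le_mul_right _ hodd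
  have : p * q * (15 * N) ≤ p * q * (7 * (Nat.card P * Nat.card Q)) := by linarith
  exact absurd (Nat.le_of_mul_le_mul_left this hpq0) (not_le.mpr h')

end CommutingProbability

theorem mem_oddPrimes_iff {p : Nat.Primes} : p ∈ oddPrimes ↔ (p : ℕ) ≠ 2 := by
  exact not_congr Subtype.ext_iff

theorem prStar_oddPrimes_isGreatest (G : Type*) [Group G] [Finite G] :
    IsGreatest (prStarBounds G oddPrimes oddPrimes) (prStar G oddPrimes oddPrimes) :=
  isGreatest_prStar G _ _ ⟨⟨3, Nat.prime_three⟩, mem_oddPrimes_iff.mpr (by simp),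
    ⟨5, Nat.prime_five⟩, mem_oddPrimes_iff.mpr (by simp), fun h => by
      simpa using congrArg Subtype.val h⟩

theorem isSolvable_of_lt_prStar (G : Type*) [Group G] [Finite G]
    (h : 7 / 15 < prStar G oddPrimes oddPrimes) : Group.IsSolvable G := by
  refine HasCommutingOddSylows.isSolvable fun p q hp hq hp2 hq2 hpq => ?_
  obtain ⟨P, Q, hPQ⟩ := (prStar_oddPrimes_isGreatest G).1 ⟨p, hp⟩ (mem_oddPrimes_iff.mpr hp2)
    ⟨q, hq⟩ (mem_oddPrimes_iff.mpr hq2) fun h => hpq (congrArg Subtype.val h)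
  exact ⟨P, Q, commute_of_lt_setPr hp hq hp2 hq2 hpq P.isPGroup' Q.isPGroup' (h.trans_le hPQ)⟩

/-! ### Sharpness for the alternating group of degree 5 -/

theorem alternatingGroup.not_isSolvable_fin_five : ¬ Group.IsSolvable (alternatingGroup (Fin 5)) :=
  fun _ => Equiv.Perm.not_isSolvable_fin_5 <|
    Group.isSolvable_of_ker_le_range (alternatingGroup (Fin 5)).subtype
      (Equiv.Perm.sign (α := Fin 5)) (by
        rw [Subgroup.range_subtype]
        exact le_rfl)

theorem Sylow.card_dvd_fifteen_of_card_eq_sixty {G : Type*} [Group G] (hG : Nat.card G = 60)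
    {p : ℕ} (hp : p.Prime) (hp2 : p ≠ 2) (P : Sylow p G) : Nat.card P ∣ 15 := by
  have := Fact.mk hp
  have : Finite G := Nat.finite_of_card_ne_zero (by rw [hG]; norm_num)
  obtain ⟨n, hn⟩ := IsPGroup.iff_card.mp P.isPGroup'
  have hdvd : Nat.card P ∣ 4 * 15 := by
    simpa only [hG] using (P : Subgroup G).card_subgroup_dvd_card
  refine Nat.Coprime.dvd_of_dvd_mul_left ?_ hdvd
  rw [hn]
  exact Nat.Coprime.pow n 2 ((Nat.coprime_primes hp Nat.prime_two).mpr hp2)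

theorem prStar_alternatingGroup_five :
    prStar (alternatingGroup (Fin 5)) oddPrimes oddPrimes = 7 / 15 := by
  refine le_antisymm (not_lt.mp fun h =>
    alternatingGroup.not_isSolvable_fin_five (isSolvable_of_lt_prStar _ h))
    ((prStar_oddPrimes_isGreatest _).2 fun p hp q hq hpq => ⟨default, default, ?_⟩)
  generalize (default : Sylow (p : ℕ) (alternatingGroup (Fin 5))) = P
  generalize (default : Sylow (q : ℕ) (alternatingGroup (Fin 5))) = Q
  have hcard : Nat.card (alternatingGroup (Fin 5)) = 60 := by
    rw [nat_card_alternatingGroup]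
    simp [Nat.factorial]
  have hP := P.card_dvd_fifteen_of_card_eq_sixty hcard p.2 (mem_oddPrimes_iff.mp hp)
  have hQ := Q.card_dvd_fifteen_of_card_eq_sixty hcard q.2 (mem_oddPrimes_iff.mp hq)
  have := Fact.mk p.2
  have := Fact.mk q.2
  have hcop : (Nat.card P).Coprime (Nat.card Q) :=
    IsPGroup.coprime_card_of_ne (p : ℕ) q (fun h => hpq (Subtype.ext h)) P.toSubgroup
      Q.toSubgroup P.isPGroup' Q.isPGroup'
  have hle := le_ncard_commuting_pairs (P : Subgroup (alternatingGroup (Fin 5))) Q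
  have hpr := setPr_coe (P : Subgroup (alternatingGroup (Fin 5))) Q
  rw [Sylow.coe_coe, Sylow.coe_coe] at hpr
  rw [hpr]
  have hpos : 0 < Nat.card P * Nat.card Q := Nat.mul_pos Nat.card_pos Nat.card_pos
  rw [le_div_iff₀ (by exact_mod_cast hpos), div_mul_eq_mul_div, div_le_iff₀ (by norm_num)]
  norm_cast
  generalize Set.ncard _ = N at *
  have h15 : Nat.divisors 15 = {1, 3, 5, 15} := by decide
  have hmem : ∀ {m}, m ∣ 15 → m = 1 ∨ m = 3 ∨ m = 5 ∨ m = 15 := fun hm => by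
    simpa [h15] using Nat.mem_divisors.mpr ⟨hm, by norm_num⟩
  generalize Nat.card P = a at *
  generalize Nat.card Q = b at *
  -- Orders 3 and 5 are the tight case, with `3 + 5 - 1 = 7` pairs out of 15; coprimality excludes
  -- the other nontrivial combinations.
  rcases hmem hP with rfl | rfl | rfl | rfl <;> rcases hmem hQ with rfl | rfl | rfl | rfl <;>
    lia

/-- Finite groups `G` with `pr*_G(2', 2') > 7/15` are soluble, and the bound is sharp: equality
`pr*_G(2', 2') = 7/15` holds for the insoluble group `A₅`. -/
theorem theorem1p4 :
    (∀ (G : Type*) [Group G] [Finite G],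
      7 / 15 < prStar G oddPrimes oddPrimes → Group.IsSolvable G) ∧
    (prStar (alternatingGroup (Fin 5)) oddPrimes oddPrimes = 7 / 15 ∧
      ¬ Group.IsSolvable (alternatingGroup (Fin 5))) := by
  exact ⟨fun G _ _ h => isSolvable_of_lt_prStar G h, prStar_alternatingGroup_five,
    alternatingGroup.not_isSolvable_fin_five⟩
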